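/- For $n\ge 1$ let $\mathcal S_n(1324,1423)$ be the set of permutations of $\{1,\dots,n\}$ that avoid both patterns $1324$ and $1423$. For permutations $\pi$ of size $m$ and $\tau$ of size $k$, the skew sum $\pi\ominus\tau$ is the permutation of size $m+k$ whose one-line notation consists of the entries of $\pi$, each increased by $k$, followed by the entries of $\tau$. A permutation is skew-indecomposable if it is not of the form $\pi\ominus\tau$ with $\pi,\tau$ nonempty. Let $G(x)=\sum_{n\ge1}a_nx^n$, where $a_n$ is the number of skew-indecomposable elements of $\mathcal S_n(1324,1423)$, and let $g(x,u)=\sum_{n\ge1}\sum_{\ell=1}^n a_{n,\ell}\,u^\ell x^n$, where $a_{n,\ell}$ is the number of those skew-indecomposable $\sigma\in\mathcal S_n(1324,1423)$ with $\sigma(\ell)=1$. Then \[ G(x)=g(x,1)=\frac{1+x-\sqrt{1-6x+x^2}}{4}, \] where $\sqrt{1-6x+x^2}$ is the formal power series with constant term $1$ whose square is $1-6x+x^2$. Thus $(a_n)_{n\ge1}=1,1,3,11,45,\dots$ is the sequence of little Schröder numbers. Moreover, the patterns $1324$ and $1423$ are both skew-indecomposable, and the class is enumerated by the large Schröder numbers: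 $|\mathcal S_{n+1}(1324,1423)|=L_n$ for all $n\ge0$, where $L_0=1$ and $L_{n+1}=L_n+\sum_{i=0}^n L_iL_{n-i}$ (so $L_n = 1,2,6,22,90,\dots$). -/

import Mathlib

namespace PermPattern

/-- `σ` contains the pattern `π`: some increasing choice of positions of `σ` carries entries
that are in the same relative order as the entries of `π`. A permutation of size `n` is an
`Equiv.Perm (Fin n)`, so positions and entries run over `0, …, n - 1`. -/
def Contains {k n : ℕ} (σ : Equiv.Perm (Fin n)) (π : Equiv.Perm (Fin k)) : Prop :=
  ∃ f : Fin k → Fin n, StrictMono f ∧ ∀ i j, σ (f i) < σ (f j) ↔ π i < π j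

/-- The set of permutations of size `n` that avoid every pattern in `P`. -/
def avoiders {k : ℕ} (P : Set (Equiv.Perm (Fin k))) (n : ℕ) : Set (Equiv.Perm (Fin n)) :=
  {σ | ∀ π ∈ P, ¬ Contains σ π}

/-- The skew sum `π ⊖ τ` of permutations of sizes `m` and `k`: the entries of `π`, raised by `k`,
followed by the entries of `τ`. -/
def skewSum {m k : ℕ} (π : Equiv.Perm (Fin m)) (τ : Equiv.Perm (Fin k)) :
    Equiv.Perm (Fin (m + k)) :=
  ((finSumFinEquiv.symm.trans (Equiv.sumCongr π τ)).trans (Equiv.sumComm (Fin m) (Fin k))).trans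
    (finSumFinEquiv.trans (finCongr (Nat.add_comm k m)))

theorem skewSum_castAdd {m k : ℕ} (π : Equiv.Perm (Fin m)) (τ : Equiv.Perm (Fin k)) (i : Fin m) :
    (skewSum π τ (Fin.castAdd k i) : ℕ) = k + (π i : ℕ) := by
  simp [skewSum, Nat.add_comm]

theorem skewSum_natAdd {m k : ℕ} (π : Equiv.Perm (Fin m)) (τ : Equiv.Perm (Fin k)) (j : Fin k) :
    (skewSum π τ (Fin.natAdd m j) : ℕ) = (τ j : ℕ) := by
  simp [skewSum]

/-- `σ` is the skew sum of two nonempty permutations. -/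
def SkewDecomposable {n : ℕ} (σ : Equiv.Perm (Fin n)) : Prop :=
  ∃ (m k : ℕ) (h : m + k = n) (π : Equiv.Perm (Fin m)) (τ : Equiv.Perm (Fin k)),
    0 < m ∧ 0 < k ∧ σ = (finCongr h).permCongr (skewSum π τ)

/-- `σ` is not the skew sum of two nonempty permutations. -/
def SkewIndecomposable {n : ℕ} (σ : Equiv.Perm (Fin n)) : Prop :=
  ¬ SkewDecomposable σ

/-- The pattern 1324 (written with entries `0, 1, 2, 3`). -/
def p1324 : Equiv.Perm (Fin 4) where
  toFun := ![0, 2, 1, 3]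
  invFun := ![0, 2, 1, 3]
  left_inv := by decide
  right_inv := by decide

/-- The pattern 1423 (written with entries `0, 1, 2, 3`). -/
def p1423 : Equiv.Perm (Fin 4) where
  toFun := ![0, 3, 1, 2]
  invFun := ![0, 2, 3, 1]
  left_inv := by decide
  right_inv := by decide

/-- The skew-indecomposable permutations of size `n` that avoid 1324 and 1423. -/
def skewIndecAvoiders (n : ℕ) : Set (Equiv.Perm (Fin n)) :=
  {σ | σ ∈ avoiders {p1324, p1423} n ∧ SkewIndecomposable σ}

/-- Those among them whose minimum stands at position `ℓ`, positions being counted from `1`. -/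
def skewIndecAvoidersAt (n ℓ : ℕ) : Set (Equiv.Perm (Fin n)) :=
  {σ | σ ∈ skewIndecAvoiders n ∧ ∃ i : Fin n, (i : ℕ) + 1 = ℓ ∧ (σ i : ℕ) = 0}

/-- `g(x, u) = ∑_{n ≥ 1} ∑_{ℓ = 1}^n a_{n,ℓ} u^ℓ x^n`, as a power series in `x` whose coefficients
are polynomials in `u`. (The inner sum is empty for `n = 0`.) -/
noncomputable def positionSeries : PowerSeries (Polynomial ℚ) :=
  PowerSeries.mk fun n =>
    ∑ ℓ ∈ Finset.Icc 1 n, Polynomial.C ((skewIndecAvoidersAt n ℓ).ncard : ℚ) * Polynomial.X ^ ℓ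

/-- `G(x)`, the generating function of the skew-indecomposable (1324, 1423)-avoiding permutations
of size `n ≥ 1`. -/
noncomputable def skewIndecSeries : PowerSeries ℚ :=
  PowerSeries.mk fun n => if n = 0 then 0 else ((skewIndecAvoiders n).ncard : ℚ)

end PermPattern

namespace PermPattern

open Equiv Finset

/-! Pass to inverses: $\rho=\sigma^{-1}$ must avoid 1324 and 1342, and inversion preserves
skew-indecomposability. Build $\rho$ by prepending entries. All that earlier entries impose on the
rest is a level $d$, as if one entry just below $d$ stood in front (`Good`). A new first entry $v<d$
lowers the level to $v$. If $v\ge d$, the level stays, and $v$ must be $d$ or the maximum: otherwise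
$d$ and the maximum both follow $v$ and create a pattern. `Prim`, which also forbids cuts, obeys the
same rule.

Both counts thus satisfy $T(n+1,d)=\sum_{v<d}T(n,v)+cT(n,d)$, with $c=2$ for $d<n$ and $c=1$ for
$d=n$. The solution is $T(n,d)=[x^n]P^{n-1-d}Q$ for $d<n$ (`coeff_eq_of_recurrence`), where
$P=x(1+L)$ and $L$ is the large Schröder series. Only the diagonal $T(n,n)$ tells the two counts
apart: it gives $Q=xL$ for `Good` and $Q=x(1+L)/2$ for `Prim`. At $d=n-1$ the level imposes nothing
beyond avoidance (and, for `Prim`, indecomposability), so $Q$ is the generating function sought. -/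

/-- The permutation with first entry `v` whose other entries are ordered as in `τ`. -/
def consPerm {n : ℕ} (v : Fin (n + 1)) (τ : Perm (Fin n)) : Perm (Fin (n + 1)) :=
  ((finSuccEquiv' 0).trans (optionCongr τ)).trans (finSuccEquiv' v).symm

@[simp]
theorem consPerm_zero {n : ℕ} (v : Fin (n + 1)) (τ : Perm (Fin n)) : consPerm v τ 0 = v := by
  simp [consPerm]

@[simp]
theorem consPerm_succ {n : ℕ} (v : Fin (n + 1)) (τ : Perm (Fin n)) (i : Fin n) :
    consPerm v τ i.succ = v.succAbove (τ i) := by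
  have : finSuccEquiv' 0 i.succ = some i := by
    rw [← Fin.succAbove_zero_apply, finSuccEquiv'_succAbove]
  simp [consPerm, this]

theorem consPerm_bijective (n : ℕ) :
    Function.Bijective fun x : Fin (n + 1) × Perm (Fin n) => consPerm x.1 x.2 := by
  rw [Fintype.bijective_iff_injective_and_card]
  constructor
  · rintro ⟨v, τ⟩ ⟨w, ρ⟩ h
    have hv : v = w := by simpa using DFunLike.congr_fun h 0
    subst hv
    refine Prod.ext rfl (Equiv.ext fun i => ?_)
    simpa using DFunLike.congr_fun h i.succ
  · simp [Fintype.card_perm, Nat.factorial_succ]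

theorem ncard_perm_succ {n : ℕ} (A : Set (Perm (Fin (n + 1)))) :
    A.ncard = ∑ v : Fin (n + 1), {τ | consPerm v τ ∈ A}.ncard := by
  have e := (Equiv.ofBijective _ (consPerm_bijective n)).subtypeEquiv
    (p := fun x => consPerm x.1 x.2 ∈ A) (q := fun ρ => ρ ∈ A) fun _ => Iff.rfl
  have e' := e.symm.trans
    (Equiv.subtypeProdEquivSigmaSubtype fun (v : Fin (n + 1)) τ => consPerm v τ ∈ A)
  rw [← Nat.card_coe_set_eq, Nat.card_congr e', Nat.card_sigma]
  rfl

theorem val_succAbove {n : ℕ} (v : Fin (n + 1)) (x : Fin n) :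
    (v.succAbove x : ℕ) = if (x : ℕ) < v then (x : ℕ) else x + 1 := by
  simp only [Fin.succAbove, Fin.lt_def, Fin.val_castSucc]
  split <;> simp

/-- Some entry has, to its right, both an entry above it and an entry between `d` and it. -/
def Split {n : ℕ} (d : ℕ) (ρ : Perm (Fin n)) : Prop :=
  ∃ b c e, b < c ∧ b < e ∧ d ≤ (ρ c : ℕ) ∧ ρ c < ρ b ∧ ρ b < ρ e

/-- `ρ` avoids 1324 and 1342, the inverses of 1324 and 1423. -/
def InvAvoids {n : ℕ} (ρ : Perm (Fin n)) : Prop :=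
  ¬ ∃ a b c e, a < b ∧ b < c ∧ b < e ∧ ρ a < ρ c ∧ ρ c < ρ b ∧ ρ b < ρ e

/-- `ρ` avoids 1324 and 1342, also after an entry placed just below the value `d` is put in
front of it. -/
def Good {n : ℕ} (d : ℕ) (ρ : Perm (Fin n)) : Prop :=
  InvAvoids ρ ∧ ¬ Split d ρ

/-- The last `k` entries of `ρ` are smaller than `k`. -/
def Cut {n : ℕ} (k : ℕ) (ρ : Perm (Fin n)) : Prop :=
  ∀ i : Fin n, n ≤ (i : ℕ) + k → (ρ i : ℕ) < k

/-- `ρ` satisfies `Good d`, and no proper prefix of it, preceded by an entry placed just below the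
value `d`, exhausts the values from some point on. -/
def Prim {n : ℕ} (d : ℕ) (ρ : Perm (Fin n)) : Prop :=
  Good d ρ ∧ ∀ k, 0 < k → k ≤ d → ¬ Cut k ρ

/-! ### Effect of prepending an entry -/

section decomposition

variable {n d : ℕ} {v : Fin (n + 1)} {τ : Perm (Fin n)}

theorem invAvoids_consPerm : InvAvoids (consPerm v τ) ↔ Good v τ := by
  constructor
  · intro h
    refine ⟨?_, ?_⟩
    · rintro ⟨a, b, c, e, h1, h2, h3, h4, h5, h6⟩
      exact h ⟨a.succ, b.succ, c.succ, e.succ, by simpa, by simpa, by simpa, by simpa, by simpa,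
        by simpa⟩
    · rintro ⟨b, c, e, h1, h2, h3, h4, h5⟩
      refine h ⟨0, b.succ, c.succ, e.succ, Fin.succ_pos _, by simpa, by simpa, ?_, by simpa,
        by simpa⟩
      rw [consPerm_zero, consPerm_succ, Fin.lt_def, val_succAbove]
      split <;> omega
  · rintro ⟨h, h'⟩ ⟨a, b, c, e, h1, h2, h3, h4, h5, h6⟩
    obtain ⟨b, rfl⟩ := Fin.exists_succ_eq.2 (Fin.ne_zero_of_lt h1)
    obtain ⟨c, rfl⟩ := Fin.exists_succ_eq.2 (Fin.ne_zero_of_lt h2)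
    obtain ⟨e, rfl⟩ := Fin.exists_succ_eq.2 (Fin.ne_zero_of_lt h3)
    simp only [consPerm_succ, Fin.succAbove_lt_succAbove_iff, Fin.succ_lt_succ_iff] at h2 h3 h5 h6
    induction a using Fin.cases with
    | zero =>
      refine h' ⟨b, c, e, h2, h3, ?_, h5, h6⟩
      rw [consPerm_zero, consPerm_succ, Fin.lt_def, val_succAbove] at h4
      split at h4 <;> omega
    | succ a =>
      exact h ⟨a, b, c, e, by simpa using h1, h2, h3, by simpa using h4, h5, h6⟩

/-- Since $v<d$, the first entry is too small to be the middle value of a split at level $d$. Such a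
split therefore lies in `τ`, where it is already a split at level $v$. -/
theorem good_consPerm_of_lt (h : (v : ℕ) < d) : Good d (consPerm v τ) ↔ Good v τ := by
  rw [Good, invAvoids_consPerm, and_iff_left_iff_imp]
  rintro ⟨-, h'⟩ ⟨b, c, e, h1, h2, h3, h4, h5⟩
  obtain ⟨c, rfl⟩ := Fin.exists_succ_eq.2 (Fin.ne_zero_of_lt h1)
  obtain ⟨e, rfl⟩ := Fin.exists_succ_eq.2 (Fin.ne_zero_of_lt h2)
  induction b using Fin.cases with
  | zero =>
    rw [consPerm_zero, Fin.lt_def] at h4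
    omega
  | succ b =>
    refine h' ⟨b, c, e, by simpa using h1, by simpa using h2, ?_, by simpa using h4,
      by simpa using h5⟩
    rw [consPerm_succ, val_succAbove] at h3
    split at h3 <;> omega

theorem Split.mono {d' : ℕ} (h : d ≤ d') (hs : Split d' τ) : Split d τ := by
  obtain ⟨b, c, e, h1, h2, h3, h4, h5⟩ := hs
  exact ⟨b, c, e, h1, h2, h.trans h3, h4, h5⟩

theorem good_consPerm_of_le (h : d ≤ (v : ℕ)) :
    Good d (consPerm v τ) ↔ Good d τ ∧ ((v : ℕ) = d ∨ (v : ℕ) = n) := by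
  rw [Good, invAvoids_consPerm]
  constructor
  · rintro ⟨⟨h1, h2⟩, h3⟩
    refine ⟨⟨h1, ?_⟩, ?_⟩
    · rintro ⟨b, c, e, h4, h5, h6, h7, h8⟩
      refine h3 ⟨b.succ, c.succ, e.succ, by simpa, by simpa, ?_, by simpa, by simpa⟩
      rw [consPerm_succ, val_succAbove]
      split <;> omega
    · by_contra! hv
      have hv' := v.2
      -- Every value other than $v$ occurs after the first entry. With $d<v<n$ this applies to $d$
      -- and $n$, which form a split with $v$.
      have hex : ∀ w : Fin (n + 1), w ≠ v → ∃ i, consPerm v τ i = w ∧ 0 < i := fun w hw =>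
        ⟨(consPerm v τ).symm w, by simp, by
          rw [Fin.pos_iff_ne_zero]
          intro h0
          apply hw
          rw [Equiv.symm_apply_eq, consPerm_zero] at h0
          exact h0⟩
      obtain ⟨c, hc, hc0⟩ := hex ⟨d, by omega⟩ (by rw [Ne, Fin.ext_iff]; simp; omega)
      obtain ⟨e, he, he0⟩ := hex ⟨n, by omega⟩ (by rw [Ne, Fin.ext_iff]; simp; omega)
      refine h3 ⟨0, c, e, hc0, he0, by rw [hc], ?_, ?_⟩
      · rw [hc, consPerm_zero, Fin.lt_def]; simp; omega
      · rw [he, consPerm_zero, Fin.lt_def]; simp; omega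
  · rintro ⟨⟨h1, h2⟩, hv⟩
    refine ⟨⟨h1, fun hs => h2 (hs.mono h)⟩, ?_⟩
    rintro ⟨b, c, e, h3, h4, h5, h6, h7⟩
    obtain ⟨c, rfl⟩ := Fin.exists_succ_eq.2 (Fin.ne_zero_of_lt h3)
    obtain ⟨e, rfl⟩ := Fin.exists_succ_eq.2 (Fin.ne_zero_of_lt h4)
    induction b using Fin.cases with
    | zero =>
      have := (consPerm v τ e.succ).2
      rw [consPerm_zero, Fin.lt_def] at h6 h7
      omega
    | succ b =>
      refine h2 ⟨b, c, e, by simpa using h3, by simpa using h4, ?_, by simpa using h6,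
        by simpa using h7⟩
      rw [consPerm_succ, val_succAbove] at h5
      split at h5 <;> omega

/-- The last $k$ positions map injectively into the values below $k$. The two sets have equal size,
so the image is everything. -/
theorem Cut.lt_iff {k : ℕ} (h : Cut k τ) (i : Fin n) :
    (τ i : ℕ) < k ↔ n ≤ (i : ℕ) + k := by
  refine ⟨fun hi => ?_, h i⟩
  have hsub : ({i : Fin n | n ≤ (i : ℕ) + k} : Finset (Fin n)).map τ.toEmbedding ⊆
      ({i : Fin n | (i : ℕ) < k} : Finset (Fin n)) := by
    intro x hx
    obtain ⟨i, hi, rfl⟩ := Finset.mem_map.1 hx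
    simpa using h i (by simpa using hi)
  have hrev : ({i : Fin n | n ≤ (i : ℕ) + k} : Finset (Fin n)) =
      ({i : Fin n | (i : ℕ) < k} : Finset (Fin n)).map Fin.revPerm.toEmbedding := by
    ext x
    simp only [mem_filter, mem_univ, true_and, mem_map_equiv, Fin.revPerm_symm, Fin.revPerm_apply,
      Fin.val_rev]
    omega
  have heq := Finset.eq_of_subset_of_card_le hsub (by rw [card_map, hrev, card_map])
  have hmem : τ i ∈ ({i : Fin n | (i : ℕ) < k} : Finset (Fin n)) := by simpa using hi
  rw [← heq] at hmem
  simpa using hmem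

theorem Cut.symm {k : ℕ} (hk : k ≤ n) (h : Cut k τ) : Cut (n - k) τ.symm := by
  intro i hi
  have := h.lt_iff (τ.symm i)
  rw [Equiv.apply_symm_apply] at this
  have := (τ.symm i).2
  omega

theorem cut_consPerm_of_le {k : ℕ} (hk : k ≤ (v : ℕ)) : Cut k (consPerm v τ) ↔ Cut k τ := by
  have hv := v.2
  rw [Cut, Fin.forall_fin_succ]
  simp only [Fin.val_zero, consPerm_succ, val_succAbove, Fin.val_succ]
  constructor
  · rintro ⟨-, h⟩ i hi
    have := h i (by omega)
    split at this <;> omega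
  · intro h
    refine ⟨by omega, fun i hi => ?_⟩
    have := h i (by omega)
    split <;> omega

theorem not_cut_consPerm_of_lt {k : ℕ} (hk : (v : ℕ) < k) (hkn : k ≤ n) :
    ¬ Cut k (consPerm v τ) := by
  intro h
  have := (h.lt_iff 0).1 (by simpa using hk)
  simp at this
  omega

/-- Cuts with $k\le v$ are those of `τ`. A cut with $v<k\le d$ would need the first position to be
among the last $k\le n$ of $n+1$. -/
theorem prim_consPerm_of_lt (hd : d ≤ n) (h : (v : ℕ) < d) :
    Prim d (consPerm v τ) ↔ Prim v τ := by
  rw [Prim, Prim, good_consPerm_of_lt h]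
  refine and_congr_right fun _ => ⟨fun H k h0 hk => ?_, fun H k h0 hk => ?_⟩
  · rw [← cut_consPerm_of_le hk]
    exact H k h0 (by omega)
  · by_cases hkv : k ≤ v
    · rw [cut_consPerm_of_le hkv]
      exact H k h0 hkv
    · exact not_cut_consPerm_of_lt (by omega) (by omega)

theorem prim_consPerm_of_le (h : d ≤ (v : ℕ)) :
    Prim d (consPerm v τ) ↔ Prim d τ ∧ ((v : ℕ) = d ∨ (v : ℕ) = n) := by
  rw [Prim, Prim, good_consPerm_of_le h, and_right_comm]
  refine and_congr_left fun _ => and_congr_right fun _ => forall_congr' fun k =>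
    forall_congr' fun _ => forall_congr' fun hk => ?_
  rw [cut_consPerm_of_le (hk.trans h)]

end decomposition

/-! ### The common recurrence and its solution -/

theorem sum_ncard_eq {n d : ℕ} (hd : d ≤ n) (K : ℕ → Set (Perm (Fin n)))
    (A : Set (Perm (Fin (n + 1))))
    (h1 : ∀ v : Fin (n + 1), (v : ℕ) < d → ∀ τ, consPerm v τ ∈ A ↔ τ ∈ K v)
    (h2 : ∀ v : Fin (n + 1), d ≤ (v : ℕ) → ∀ τ, consPerm v τ ∈ A ↔
      τ ∈ K d ∧ ((v : ℕ) = d ∨ (v : ℕ) = n)) :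
    A.ncard = ∑ v ∈ range d, (K v).ncard + (if d < n then 2 else 1) * (K d).ncard := by
  have key : ∀ v : Fin (n + 1), {τ | consPerm v τ ∈ A}.ncard =
      (fun v : ℕ => if v < d then (K v).ncard else
        if v = d ∨ v = n then (K d).ncard else 0) v := by
    intro v
    dsimp only
    split_ifs with hv hv'
    · congr 1; ext τ; exact h1 v hv τ
    · congr 1; ext τ; simp [h2 v (not_lt.1 hv) τ, hv']
    · rw [Set.ncard_eq_zero]
      ext τ
      simp [h2 v (not_lt.1 hv) τ, hv']
  rw [ncard_perm_succ, Finset.sum_congr rfl fun v _ => key v,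
    Fin.sum_univ_eq_sum_range (fun v : ℕ => if v < d then (K v).ncard else
      if v = d ∨ v = n then (K d).ncard else 0),
    ← Finset.sum_range_add_sum_Ico _ (by omega : d ≤ n + 1)]
  congr 1
  · exact Finset.sum_congr rfl fun v hv => if_pos (Finset.mem_range.1 hv)
  · have : ∀ v ∈ Ico d (n + 1), (if v < d then (K v).ncard else
        if v = d ∨ v = n then (K d).ncard else 0) =
        if v ∈ ({d, n} : Finset ℕ) then (K d).ncard else 0 := by
      intro v hv
      rw [if_neg (by simp at hv; omega)]
      simp
    rw [Finset.sum_congr rfl this, ← Finset.sum_filter, Finset.sum_const, smul_eq_mul]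
    congr 1
    have hf : (Ico d (n + 1)).filter (· ∈ ({d, n} : Finset ℕ)) = {d, n} := by
      ext v; simp; omega
    rw [hf]
    -- The two admissible values $d$ and $n$ coincide exactly when $d=n$.
    split_ifs with h
    · exact Finset.card_pair h.ne
    · rw [show d = n by omega]; simp

section series

open PowerSeries

/-- Subtracting the recurrences at $d+1$ and $d$ gives $T(n+1,d+1)=T(n+1,d)-T(n,d)+cT(n,d+1)$. For
$c=2$ the coefficients of $P^{n-1-d}Q$ satisfy it because of `hP`. For $c=1$, where $d+1=n$, it is
the value of $T(n,n)$ prescribed by `hdiag`. -/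
theorem coeff_eq_of_recurrence (P Q : PowerSeries ℚ) (T : ℕ → ℕ → ℚ) (P' Q' : PowerSeries ℚ)
    (hP' : P = X * P') (hQ' : Q = X * Q') (hP0 : constantCoeff P' = 2)
    (hQ0 : constantCoeff Q' = 1)
    (hP : P - P ^ 2 = 2 * X - X * P)
    (h00 : T 0 0 = 1)
    (hrec : ∀ n d, d ≤ n → T (n + 1) d =
      ∑ v ∈ range d, T n v + (if d < n then 2 else 1) * T n d)
    (hdiag : ∀ n, (∀ d < n, T n d = coeff n (P ^ (n - 1 - d) * Q)) →
      T n n = coeff (n + 1) (Q - P * Q + X * Q))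
    (n d : ℕ) (hd : d < n) : T n d = coeff n (P ^ (n - 1 - d) * Q) := by
  induction n generalizing d with
  | zero => omega
  | succ n ih =>
    induction d with
    | zero =>
      -- The lowest terms of $P$ and $Q$ are $2x$ and $x$, which matches the doubling at level $0$.
      have hc : ∀ m, coeff (m + 1) (P ^ m * Q) = 2 ^ m := fun m => by
        rw [hP', hQ', show (X * P') ^ m * (X * Q') = X ^ (m + 1) * (P' ^ m * Q') by ring,
          coeff_X_pow_mul', if_pos le_rfl]
        simp [hP0, hQ0]
      rw [hrec n 0 (Nat.zero_le _)]
      rcases n with _ | n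
      · simpa [h00] using (hc 0).symm
      · have := ih 0 (by omega)
        simp only [Nat.add_sub_cancel, Nat.sub_zero] at this ⊢
        rw [hc, this, hc]
        simp [pow_succ, mul_comm]
    | succ d ihd =>
      have hdn : d < n := by omega
      have h1 := ihd (by omega)
      rw [hrec n d hdn.le, if_pos hdn] at h1
      rw [hrec n (d + 1) (by omega), Finset.sum_range_succ]
      have h2 := ih d hdn
      obtain ⟨k, rfl⟩ : ∃ k, n = d + 1 + k := ⟨n - d - 1, by omega⟩
      rw [show d + 1 + k - 1 - d = k by omega] at h2
      rw [show d + 1 + k + 1 - 1 - d = k + 1 by omega] at h1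
      rw [show d + 1 + k + 1 - 1 - (d + 1) = k by omega]
      rcases k with _ | k
      · have h3 := hdiag _ ih
        simp only [Nat.add_zero, lt_irrefl, if_false, map_add, map_sub, coeff_succ_X_mul,
          zero_add, pow_one, pow_zero, one_mul] at *
        linarith
      · have h3 := ih (d + 1) (by omega)
        rw [show d + 1 + (k + 1) - 1 - (d + 1) = k by omega] at h3
        rw [if_pos (by omega)]
        have h4 : P ^ (k + 1) * Q = P ^ (k + 1 + 1) * Q + X * (P ^ k * Q) + X * (P ^ k * Q)
            - X * (P ^ (k + 1) * Q) := by
          linear_combination (P ^ k * Q) * hP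
        have h5 := congrArg (coeff (d + 1 + (k + 1) + 1)) h4
        simp only [map_add, map_sub, coeff_succ_X_mul] at h5
        linarith

/-- The generating function of the large Schröder numbers, over `ℚ`. -/
noncomputable def schroderSeries : PowerSeries ℚ :=
  PowerSeries.map (Nat.castRingHom ℚ) largeSchroderSeries

theorem coeff_schroderSeries (n : ℕ) : coeff n schroderSeries = (Nat.largeSchroder n : ℚ) := by
  simp [schroderSeries]

theorem constantCoeff_schroderSeries : constantCoeff schroderSeries = 1 := by
  rw [← coeff_zero_eq_constantCoeff_apply, coeff_schroderSeries]
  simp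

theorem schroderSeries_eq :
    schroderSeries = 1 + X * schroderSeries + X * schroderSeries ^ 2 := by
  have := congrArg (PowerSeries.map (Nat.castRingHom ℚ))
    largeSchroderSeries_eq_one_add_X_mul_largeSchroderSeries_add_X_mul_largeSchroderSeries_sq
  simpa [schroderSeries] using this

end series

/-! ### The two counts -/

theorem ncard_good_succ {n d : ℕ} (hd : d ≤ n) :
    {ρ : Perm (Fin (n + 1)) | Good d ρ}.ncard = ∑ v ∈ range d, {ρ : Perm (Fin n) | Good v ρ}.ncard +
      (if d < n then 2 else 1) * {ρ : Perm (Fin n) | Good d ρ}.ncard :=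
  sum_ncard_eq hd (fun d => {ρ | Good d ρ}) _ (fun _ h _ => good_consPerm_of_lt h)
    fun _ h _ => good_consPerm_of_le h

theorem ncard_prim_succ {n d : ℕ} (hd : d ≤ n) :
    {ρ : Perm (Fin (n + 1)) | Prim d ρ}.ncard = ∑ v ∈ range d, {ρ : Perm (Fin n) | Prim v ρ}.ncard +
      (if d < n then 2 else 1) * {ρ : Perm (Fin n) | Prim d ρ}.ncard :=
  sum_ncard_eq hd (fun d => {ρ | Prim d ρ}) _ (fun _ h _ => prim_consPerm_of_lt hd h)
    fun _ h _ => prim_consPerm_of_le h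

theorem good_iff_invAvoids {n d : ℕ} (hd : n ≤ d + 1) (ρ : Perm (Fin n)) :
    Good d ρ ↔ InvAvoids ρ := by
  rw [Good, and_iff_left_iff_imp]
  rintro - ⟨b, c, e, h1, h2, h3, h4, h5⟩
  have := (ρ b).2
  rw [Fin.lt_def] at h4
  omega

open PowerSeries in
theorem ncard_good_eq (n : ℕ) :
    {ρ : Perm (Fin (n + 1)) | Good n ρ}.ncard = Nat.largeSchroder n := by
  have hL := schroderSeries_eq
  have := coeff_eq_of_recurrence (X * (1 + schroderSeries)) (X * schroderSeries)
    (fun n d => ({ρ : Perm (Fin n) | Good d ρ}.ncard : ℚ)) (1 + schroderSeries) schroderSeries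
    rfl rfl (by rw [map_add, constantCoeff_schroderSeries]; norm_num) constantCoeff_schroderSeries
    (by linear_combination X * hL)
    (by
      have : {ρ : Perm (Fin 0) | Good 0 ρ} = Set.univ := by
        ext ρ
        simp [Good, InvAvoids, Split]
      simp [this, Set.ncard_univ])
    (fun n d hd => by simp only [ncard_good_succ hd]; push_cast; rfl)
    (fun n ih => by
      have e : X * schroderSeries - X * (1 + schroderSeries) * (X * schroderSeries) +
          X * (X * schroderSeries) = X * (1 + X * schroderSeries) := by
        linear_combination X * hL
      rw [e, coeff_succ_X_mul]
      rcases n with _ | n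
      · have : {ρ : Perm (Fin 0) | Good 0 ρ} = Set.univ := by
          ext ρ
          simp [Good, InvAvoids, Split]
        simp [this, Set.ncard_univ]
      -- On `Fin (n + 1)` the levels $n$ and $n+1$ both impose plain avoidance, so the diagonal
      -- value equals the one beside it.
      · have h := ih n (by omega)
        simp only [good_iff_invAvoids (Nat.le_succ _), good_iff_invAvoids le_rfl] at h ⊢
        rw [h]
        simp [coeff_one])
    (n + 1) n (by omega)
  simp only [Nat.add_sub_cancel, Nat.sub_self, pow_zero, one_mul, coeff_succ_X_mul,
    coeff_schroderSeries] at this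
  exact_mod_cast this

open PowerSeries in
theorem ncard_prim_eq (n : ℕ) :
    ({ρ : Perm (Fin (n + 1)) | Prim n ρ}.ncard : ℚ) =
      coeff n (C (1 / 2 : ℚ) * (1 + schroderSeries)) := by
  have hL := schroderSeries_eq
  have h2 : (C (1 / 2 : ℚ) * 2 : PowerSeries ℚ) = 1 := by
    rw [← map_ofNat (C (R := ℚ)) 2, ← map_mul]; norm_num
  have h0 : {ρ : Perm (Fin 0) | Prim 0 ρ} = Set.univ := by
    ext ρ
    simp [Prim, Good, InvAvoids, Split]
    omega
  have := coeff_eq_of_recurrence (X * (1 + schroderSeries))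
    (X * (C (1 / 2 : ℚ) * (1 + schroderSeries)))
    (fun n d => ({ρ : Perm (Fin n) | Prim d ρ}.ncard : ℚ)) (1 + schroderSeries) _
    rfl rfl (by rw [map_add, constantCoeff_schroderSeries]; norm_num)
    (by simp only [map_mul, map_add, constantCoeff_schroderSeries]; norm_num)
    (by linear_combination X * hL)
    (by simp [h0, Set.ncard_univ])
    (fun n d hd => by simp only [ncard_prim_succ hd]; push_cast; rfl)
    (fun n ih => by
      have e : X * (C (1 / 2 : ℚ) * (1 + schroderSeries)) -
          X * (1 + schroderSeries) * (X * (C (1 / 2 : ℚ) * (1 + schroderSeries))) +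
          X * (X * (C (1 / 2 : ℚ) * (1 + schroderSeries))) = X * 1 := by
        linear_combination X * C (1 / 2 : ℚ) * hL + X * h2
      rw [e, coeff_succ_X_mul]
      rcases n with _ | n
      · simp [h0, Set.ncard_univ]
      -- Taking all entries, $k=n+1$, is always a cut, so the diagonal vanishes for positive sizes.
      · have : {ρ : Perm (Fin (n + 1)) | Prim (n + 1) ρ} = ∅ := by
          ext ρ
          simp only [Set.mem_ofPred_eq, Set.mem_empty_iff_false, iff_false]
          exact fun h => h.2 (n + 1) (by omega) le_rfl fun i _ => (ρ i).2
        simp [this, coeff_one])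
    (n + 1) n (by omega)
  simpa only [Nat.add_sub_cancel, Nat.sub_self, pow_zero, one_mul, coeff_succ_X_mul] using this

/-! ### Return to the patterns and to skew sums -/

theorem mem_avoiders_iff {n : ℕ} (σ : Perm (Fin n)) :
    σ ∈ avoiders {p1324, p1423} n ↔ InvAvoids σ.symm := by
  rw [avoiders, Set.mem_ofPred_eq, InvAvoids]
  constructor
  · rintro h ⟨a, b, c, e, h1, h2, h3, h4, h5, h6⟩
    have hm : StrictMono ![σ.symm a, σ.symm c, σ.symm b, σ.symm e] := by
      rw [Fin.strictMono_iff_lt_succ]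
      intro i
      fin_cases i <;> simpa
    -- `InvAvoids` leaves the order of $c$ and $e$ open; the two orders give the two patterns.
    rcases lt_or_gt_of_ne (show c ≠ e by rintro rfl; exact lt_asymm h5 h6) with hce | hce
    · refine h p1324 (by simp) ⟨_, hm, fun i j => ?_⟩
      fin_cases i <;> fin_cases j <;> simp [p1324] <;> omega
    · refine h p1423 (by simp) ⟨_, hm, fun i j => ?_⟩
      fin_cases i <;> fin_cases j <;> simp [p1423] <;> omega
  · rintro h π (rfl | rfl) ⟨f, hf, H⟩
    · refine h ⟨σ (f 0), σ (f 2), σ (f 1), σ (f 3), ?_⟩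
      simp only [H, Equiv.symm_apply_apply, hf.lt_iff_lt]
      decide
    · refine h ⟨σ (f 0), σ (f 2), σ (f 1), σ (f 3), ?_⟩
      simp only [H, Equiv.symm_apply_apply, hf.lt_iff_lt]
      decide

theorem skewDecomposable_iff {n : ℕ} (σ : Perm (Fin n)) :
    SkewDecomposable σ ↔ ∃ k, 0 < k ∧ k < n ∧ Cut k σ := by
  constructor
  · rintro ⟨m, k, rfl, π, τ, hm, hk, rfl⟩
    refine ⟨k, hk, by omega, fun i hi => ?_⟩
    induction i using Fin.addCases with
    | left i => simp at hi; omega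
    | right i =>
      have := skewSum_natAdd π τ i
      simp [this]
  · rintro ⟨k, hk, hkn, h⟩
    obtain ⟨m, rfl⟩ : ∃ m, n = m + k := ⟨n - k, by omega⟩
    have hlt := h.lt_iff
    have hl : ∀ i : Fin m, k ≤ (σ (Fin.castAdd k i) : ℕ) := fun i => by
      have := hlt (Fin.castAdd k i)
      simp only [Fin.val_castAdd] at this
      omega
    have hr : ∀ i : Fin k, (σ (Fin.natAdd m i) : ℕ) < k := fun i => h _ (by simp)
    let f : Fin m → Fin m := fun i => ⟨σ (Fin.castAdd k i) - k, by
      have := (σ (Fin.castAdd k i)).2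
      have := hl i
      omega⟩
    let g : Fin k → Fin k := fun i => ⟨σ (Fin.natAdd m i), hr i⟩
    have hf : Function.Injective f := fun i j hij => by
      have h1 := hl i
      have h2 := hl j
      have h3 : (σ (Fin.castAdd k i) : ℕ) - k = σ (Fin.castAdd k j) - k := congrArg Fin.val hij
      exact Fin.castAdd_injective m k (σ.injective (Fin.ext (by omega)))
    have hg : Function.Injective g := fun i j hij =>
      Fin.natAdd_injective k m (σ.injective (Fin.ext (congrArg Fin.val hij :)))
    refine ⟨m, k, rfl, Equiv.ofBijective f (Finite.injective_iff_bijective.1 hf),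
      Equiv.ofBijective g (Finite.injective_iff_bijective.1 hg), by omega, hk, ?_⟩
    ext i
    simp only [finCongr_refl, Equiv.permCongr_def, Equiv.refl_symm, Equiv.refl_trans,
      Equiv.trans_refl]
    induction i using Fin.addCases with
    | left i =>
      rw [skewSum_castAdd]
      have := hl i
      simp [f]
      omega
    | right i =>
      rw [skewSum_natAdd]
      simp [g]

/-- Inversion swaps the two blocks of a skew sum, turning a cut at $k$ into one at $n+1-k$. Level
$n$ admits exactly the proper cuts $1\le k\le n$. -/
theorem mem_skewIndecAvoiders_iff {n : ℕ} (σ : Perm (Fin (n + 1))) :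
    σ ∈ skewIndecAvoiders (n + 1) ↔ Prim n σ.symm := by
  rw [skewIndecAvoiders, Set.mem_ofPred_eq, Prim, good_iff_invAvoids le_rfl, mem_avoiders_iff,
    SkewIndecomposable, skewDecomposable_iff]
  refine and_congr_right fun _ => ⟨fun h k h0 hk hc => ?_, fun h => ?_⟩
  · exact h ⟨n + 1 - k, by omega, by omega, hc.symm (by omega)⟩
  · rintro ⟨k, h0, hk, hc⟩
    exact h (n + 1 - k) (by omega) (by omega) (hc.symm hk.le)

theorem ncard_setOf_symm {n : ℕ} (p : Perm (Fin n) → Prop) :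
    {σ : Perm (Fin n) | p σ.symm}.ncard = {ρ | p ρ}.ncard := by
  rw [← Nat.card_coe_set_eq, ← Nat.card_coe_set_eq]
  exact Nat.card_congr ((Equiv.inv (Perm (Fin n))).subtypeEquiv fun _ => Iff.rfl)

theorem ncard_avoiders (n : ℕ) :
    (avoiders {p1324, p1423} (n + 1)).ncard = Nat.largeSchroder n := by
  rw [← ncard_good_eq, ← ncard_setOf_symm]
  congr 1
  ext σ
  rw [mem_avoiders_iff, Set.mem_ofPred_eq, good_iff_invAvoids le_rfl]

open PowerSeries in
theorem ncard_skewIndecAvoiders (n : ℕ) :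
    ((skewIndecAvoiders (n + 1)).ncard : ℚ) = coeff n (C (1 / 2 : ℚ) * (1 + schroderSeries)) := by
  rw [← ncard_prim_eq, ← ncard_setOf_symm]
  congr 2
  ext σ
  exact mem_skewIndecAvoiders_iff σ

theorem ncard_skewIndecAvoiders_eq_smallSchroder (n : ℕ) :
    (skewIndecAvoiders (n + 1)).ncard = Nat.smallSchroder (n + 1) := by
  have h := ncard_skewIndecAvoiders n
  rw [PowerSeries.coeff_C_mul, map_add, coeff_schroderSeries, PowerSeries.coeff_one] at h
  rcases n with _ | n
  · norm_num at h
    simpa using h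
  · rw [← Nat.two_mul_smallSchroder_succ (Nat.succ_ne_zero n), if_neg (Nat.succ_ne_zero n)] at h
    push_cast at h
    rw [zero_add, ← mul_assoc, one_div, inv_mul_cancel₀ two_ne_zero, one_mul] at h
    exact_mod_cast h

/-! ### Generating functions -/

open PowerSeries in
theorem skewIndecSeries_eq :
    skewIndecSeries = X * (C (1 / 2 : ℚ) * (1 + schroderSeries)) := by
  ext n
  rcases n with _ | n
  · simp [skewIndecSeries]
  · rw [coeff_succ_X_mul, ← ncard_skewIndecAvoiders]
    simp [skewIndecSeries]

theorem sum_ncard_skewIndecAvoidersAt {n : ℕ} (hn : n ≠ 0) :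
    ∑ ℓ ∈ Icc 1 n, (skewIndecAvoidersAt n ℓ).ncard = (skewIndecAvoiders n).ncard := by
  classical
  obtain ⟨n, rfl⟩ := Nat.exists_eq_succ_of_ne_zero hn
  rw [Set.ncard_eq_toFinset_card',
    Finset.card_eq_sum_card_fiberwise (f := fun σ : Perm (Fin (n + 1)) => (σ.symm 0 : ℕ) + 1)
      (t := Icc 1 (n + 1))]
  · refine Finset.sum_congr rfl fun ℓ _ => ?_
    rw [Set.ncard_eq_toFinset_card']
    congr 1
    ext σ
    rw [Finset.mem_filter, Set.mem_toFinset, Set.mem_toFinset]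
    refine and_congr_right fun _ => ⟨?_, fun h => ⟨σ.symm 0, h, by simp⟩⟩
    rintro ⟨i, hi, h0⟩
    rw [← hi, show σ.symm 0 = i from by rw [Equiv.symm_apply_eq]; exact Fin.ext h0.symm]
  · intro σ _
    have := (σ.symm 0).2
    simp only [Finset.coe_Icc, Set.mem_Icc]
    omega

theorem skewIndecSeries_eq_map_positionSeries :
    skewIndecSeries = PowerSeries.map (Polynomial.evalRingHom (1 : ℚ)) positionSeries := by
  ext n
  simp only [skewIndecSeries, positionSeries, PowerSeries.coeff_mk, PowerSeries.coeff_map,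
    Polynomial.coe_evalRingHom, Polynomial.eval_finsetSum, Polynomial.eval_mul, Polynomial.eval_C,
    Polynomial.eval_pow, Polynomial.eval_X, one_pow, mul_one]
  split_ifs with h
  · simp [h]
  · exact_mod_cast (sum_ncard_skewIndecAvoidersAt h).symm

theorem skewIndecomposable_of_apply_zero {n : ℕ} {σ : Perm (Fin (n + 1))} (h : σ 0 = 0) :
    SkewIndecomposable σ := by
  rw [SkewIndecomposable, skewDecomposable_iff]
  rintro ⟨k, h0, hk, hc⟩
  have := (hc.lt_iff 0).1 (by simpa [h])
  simp at this
  omega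

end PermPattern

theorem mainTheorem3 :
    PermPattern.skewIndecSeries =
        PowerSeries.map (Polynomial.evalRingHom (1 : ℚ)) PermPattern.positionSeries ∧
    (∃ R : PowerSeries ℚ,
      PowerSeries.constantCoeff R = 1 ∧
      R ^ 2 = 1 - 6 * PowerSeries.X + PowerSeries.X ^ 2 ∧
      PermPattern.skewIndecSeries = PowerSeries.C (1 / 4 : ℚ) * (1 + PowerSeries.X - R)) ∧
    (∀ n : ℕ, 1 ≤ n → (PermPattern.skewIndecAvoiders n).ncard = Nat.smallSchroder n) ∧
    PermPattern.SkewIndecomposable PermPattern.p1324 ∧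
    PermPattern.SkewIndecomposable PermPattern.p1423 ∧
    (∀ n : ℕ,
      (PermPattern.avoiders {PermPattern.p1324, PermPattern.p1423} (n + 1)).ncard =
        Nat.largeSchroder n) := by
  open PowerSeries in
  -- The root is $1+x-4G$ with $G=x(1+L)/2$.
  refine ⟨PermPattern.skewIndecSeries_eq_map_positionSeries,
    ⟨1 + X - 2 * (X * (1 + PermPattern.schroderSeries)), ?_, ?_, ?_⟩, ?_,
    PermPattern.skewIndecomposable_of_apply_zero rfl, PermPattern.skewIndecomposable_of_apply_zero rfl,
    PermPattern.ncard_avoiders⟩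
  · simp
  · linear_combination -4 * X * PermPattern.schroderSeries_eq
  · have h4 : (C (1 / 4 : ℚ) * 2 : PowerSeries ℚ) = C (1 / 2 : ℚ) := by
      rw [← map_ofNat (C (R := ℚ)) 2, ← map_mul]; norm_num
    rw [PermPattern.skewIndecSeries_eq, ← h4]
    ring
  · intro n hn
    obtain ⟨n, rfl⟩ := Nat.exists_eq_succ_of_ne_zero (Nat.one_le_iff_ne_zero.1 hn)
    exact PermPattern.ncard_skewIndecAvoiders_eq_smallSchroder n
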